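/- Let $A\in\mathbb R^{n\times n}$, $B\in\mathbb R^{n\times p}$, $C\in\mathbb R^{m\times n}$, let $P_0\in\mathbb R^{n\times n}$ be symmetric and non-negative, and let $0<T<\infty$. For $0\le\tau\le T$, $\xi\in\mathbb R^n$ and $u\in L^2((\tau,T);\mathbb R^p)$ let $x\in C([\tau,T];\mathbb R^n)$ be the solution of $x'=Ax+Bu$ in $(\tau,T)$, $x(\tau)=\xi$, that is, $x(s)=\xi+\int_\tau^s (Ax(r)+Bu(r))\,dr$ for $s\in[\tau,T]$, and put $$J_{\tau,T}(x,u)=\int_\tau^T\big(\|Cx(s)\|^2+\|u(s)\|^2\big)\,ds+\langle P_0x(T),x(T)\rangle .$$ For every $\tau\in[0,T]$ there is exactly one symmetric matrix $P_T(\tau)\in\mathbb R^{n\times n}$ such that for all $\xi\in\mathbb R^n$ $$\langle P_T(\tau)\xi,\xi\rangle=\inf_{u\in L^2((\tau,T);\mathbb R^p)}J_{\tau,T}(x,u),\qquad\text{where } x'=Ax+Bu \text{ in } (\tau,T),\ x(\tau)=\xi .$$ Let $\xi\in\mathbb R^n$. There is exactly one control $\tilde u\in L^2((0,T);\mathbb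 R^p)$ (up to equality almost everywhere) which, with the corresponding solution $\tilde x$, minimizes $J_{0,T}$ among all $u\in L^2((0,T);\mathbb R^p)$ and the corresponding solutions $x$ starting from $x(0)=\xi$. It satisfies $$\tilde x'=A\tilde x+B\tilde u\ \text{ in }(0,T),\qquad \tilde x(0)=\xi,$$ $$\tilde u=-B^\top\tilde y\ \text{ almost everywhere in }(0,T),$$ where the adjoint state $\tilde y\in C([0,T];\mathbb R^n)$ is the solution of $$\tilde y'=-A^\top\tilde y-C^\top C\tilde x\ \text{ in }(0,T),\qquad \tilde y(T)=P_0\tilde x(T).$$ Moreover, $$\tilde y(t)=P_T(t)\tilde x(t)\quad\text{for all } t\in[0,T],$$ and consequently $$\tilde u(t)=-B^\top P_T(t)\tilde x(t)\quad\text{for almost every } t\in[0,T].$$ -/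

import Mathlib

open MeasureTheory Set

/-- `u ∈ L²((t, T); ℝᵖ)`. -/
def IsLQControl {p : ℕ} (t T : ℝ) (u : ℝ → EuclideanSpace ℝ (Fin p)) : Prop :=
  MemLp u 2 (volume.restrict (Ioo t T))

/-- `x ∈ C([t, T]; ℝⁿ)` is the solution of `x' = A x + B u` in `(t, T)`, `x(t) = ξ`, in the
(integral) sense used for an `L²` control `u`. -/
def IsLQTrajectory {n p : ℕ} (A : Matrix (Fin n) (Fin n) ℝ) (B : Matrix (Fin n) (Fin p) ℝ)
    (t T : ℝ) (ξ : EuclideanSpace ℝ (Fin n)) (x : ℝ → EuclideanSpace ℝ (Fin n))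
    (u : ℝ → EuclideanSpace ℝ (Fin p)) : Prop :=
  ContinuousOn x (Icc t T) ∧
    ∀ s ∈ Icc t T,
      x s = ξ + ∫ r in t..s, (Matrix.toEuclideanLin A (x r) + Matrix.toEuclideanLin B (u r))

/-- `(x, u)` is admissible from time `t` and state `ξ`: `u` is an `L²` control on `(t, T)` and `x`
is the corresponding solution. -/
def IsLQAdmissible {n p : ℕ} (A : Matrix (Fin n) (Fin n) ℝ) (B : Matrix (Fin n) (Fin p) ℝ)
    (t T : ℝ) (ξ : EuclideanSpace ℝ (Fin n)) (x : ℝ → EuclideanSpace ℝ (Fin n))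
    (u : ℝ → EuclideanSpace ℝ (Fin p)) : Prop :=
  IsLQControl t T u ∧ IsLQTrajectory A B t T ξ x u

/-- The cost `J_{t,T}(x, u) = ∫_t^T (‖C x‖² + ‖u‖²) ds + ⟨P₀ x(T), x(T)⟩`. -/
noncomputable def lqCost {n p m : ℕ} (C : Matrix (Fin m) (Fin n) ℝ) (P₀ : Matrix (Fin n) (Fin n) ℝ)
    (t T : ℝ) (x : ℝ → EuclideanSpace ℝ (Fin n)) (u : ℝ → EuclideanSpace ℝ (Fin p)) : ℝ :=
  (∫ s in t..T, (‖Matrix.toEuclideanLin C (x s)‖ ^ 2 + ‖u s‖ ^ 2)) +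
    inner ℝ (Matrix.toEuclideanLin P₀ (x T)) (x T)

/-- `(x, u)` is an optimal solution of the problem on `(t, T)` with initial state `ξ`. -/
def IsLQOptimal {n p m : ℕ} (A : Matrix (Fin n) (Fin n) ℝ) (B : Matrix (Fin n) (Fin p) ℝ)
    (C : Matrix (Fin m) (Fin n) ℝ) (P₀ : Matrix (Fin n) (Fin n) ℝ)
    (t T : ℝ) (ξ : EuclideanSpace ℝ (Fin n)) (x : ℝ → EuclideanSpace ℝ (Fin n))
    (u : ℝ → EuclideanSpace ℝ (Fin p)) : Prop :=
  IsLQAdmissible A B t T ξ x u ∧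
    ∀ x' u', IsLQAdmissible A B t T ξ x' u' → lqCost C P₀ t T x u ≤ lqCost C P₀ t T x' u'

/-- `P` is the matrix `P_T(τ)`: it is symmetric and, for every `ξ`, `⟨P ξ, ξ⟩` is the infimum of the
cost over `(τ, T)` with initial state `ξ` at time `τ`. For `τ = T` every admissible pair has
`x(T) = ξ`, so that the infimum is `⟨P₀ ξ, ξ⟩`. -/
def IsLQValueMatrix {n p m : ℕ} (A : Matrix (Fin n) (Fin n) ℝ) (B : Matrix (Fin n) (Fin p) ℝ)
    (C : Matrix (Fin m) (Fin n) ℝ) (P₀ : Matrix (Fin n) (Fin n) ℝ)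
    (T τ : ℝ) (P : Matrix (Fin n) (Fin n) ℝ) : Prop :=
  P.IsSymm ∧
    ∀ ξ : EuclideanSpace ℝ (Fin n),
      IsGLB {J : ℝ | ∃ x u, IsLQAdmissible A B τ T ξ x u ∧ J = lqCost C P₀ τ T x u}
        (inner ℝ (Matrix.toEuclideanLin P ξ) ξ)

/-- `y` is the adjoint state of `x`: `y' = -Aᵀ y - Cᵀ C x` in `(0, T)`, `y(T) = P₀ x(T)`.
As `x` is continuous, this is a classical equation. -/
def IsLQAdjointState {n m : ℕ} (A : Matrix (Fin n) (Fin n) ℝ)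
    (C : Matrix (Fin m) (Fin n) ℝ) (P₀ : Matrix (Fin n) (Fin n) ℝ)
    (T : ℝ) (x y : ℝ → EuclideanSpace ℝ (Fin n)) : Prop :=
  ContinuousOn y (Icc 0 T) ∧
    (∀ t ∈ Ioo 0 T, HasDerivAt y
      (-Matrix.toEuclideanLin A.transpose (y t) - Matrix.toEuclideanLin (C.transpose * C) (x t)) t) ∧
    y T = Matrix.toEuclideanLin P₀ (x T)

/-! Every extremal, a solution `(x, y)` of the Hamiltonian system with `y T = p (x T)`, is a
minimizer. Completing the square (`cost_eq`) writes the cost of any admissible pair starting from `x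
τ` as `⟨y τ, x τ⟩` plus nonnegative deviation terms, which vanish for `x` with the control `-b† y`.
This gives the minimum value and its attainment, and, since zero deviation forces the control and
hence the state (`eq_of_cost_le`), uniqueness.

It remains to find an extremal through every state `ξ` at every time `τ ≤ T`. Extremals depend
linearly on the terminal state `v`: `x t = X t v`, `y t = Y t v`. The energy identity and `p ≥ 0`
make `X t` injective (`state_terminal_eq_zero`), hence invertible in finite dimension, so `y t = P t
(x t)` with `P t = Y t ∘ (X t)⁻¹`. Conservation of the symplectic form makes `P t` symmetric. The
minimum from time `t` is thus `⟨P t ξ, ξ⟩`, which identifies `P t` with the value matrix and yields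
the feedback law without the Riccati equation. -/

section Abstract

variable {E F G : Type*} [NormedAddCommGroup E] [InnerProductSpace ℝ E] [FiniteDimensional ℝ E]
  [NormedAddCommGroup F] [InnerProductSpace ℝ F] [FiniteDimensional ℝ F]
  [NormedAddCommGroup G] [InnerProductSpace ℝ G] [FiniteDimensional ℝ G]

open ContinuousLinearMap in
/-- Solutions of the Hamiltonian system `x' = a x - b b† y`, `y' = -a† y - c† c x`. -/
def IsHamiltonianSolution (a : E →L[ℝ] E) (b : F →L[ℝ] E) (c : E →L[ℝ] G) (x y : ℝ → E) : Prop :=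
  ∀ t, HasDerivAt x (a (x t) - b (adjoint b (y t))) t ∧
    HasDerivAt y (-adjoint a (y t) - adjoint c (c (x t))) t

theorem exists_linear_flow {V : Type*} [NormedAddCommGroup V] [NormedSpace ℝ V] [CompleteSpace V]
    (H : V →L[ℝ] V) (T : ℝ) :
    ∃ S : ℝ → V →L[ℝ] V, (∀ v t, HasDerivAt (fun s => S s v) (H (S t v)) t) ∧ ∀ v, S T v = v := by
  refine ⟨fun t => NormedSpace.exp ((t - T) • H), fun v t => ?_, fun v => by simp⟩
  have h := (hasDerivAt_exp_smul_const' (𝕂 := ℝ) H (t - T)).comp_sub_const t T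
  exact (h.clm_apply (hasDerivAt_const t v)).congr_deriv (by simp)

-- Flowing backwards from the graph of `p` at time `T` builds in the terminal condition and turns a
-- two-point boundary value problem into the invertibility of `X t`.
open ContinuousLinearMap in
theorem exists_hamiltonian_flow (a : E →L[ℝ] E) (b : F →L[ℝ] E) (c : E →L[ℝ] G)
    (p : E →L[ℝ] E) (T : ℝ) :
    ∃ X Y : ℝ → E →ₗ[ℝ] E, (∀ v, X T v = v) ∧ (∀ v, Y T v = p v) ∧
      ∀ v, IsHamiltonianSolution a b c (fun t => X t v) (fun t => Y t v) := by
  let H : E × E →L[ℝ] E × E :=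
    ((a.comp (fst ℝ E E) - (b.comp (adjoint b)).comp (snd ℝ E E))).prod
      (-(adjoint a).comp (snd ℝ E E) - ((adjoint c).comp c).comp (fst ℝ E E))
  obtain ⟨S, hS, hST⟩ := exists_linear_flow H T
  let Z : ℝ → E →L[ℝ] E × E := fun t => (S t).comp ((ContinuousLinearMap.id ℝ E).prod p)
  have hZ : ∀ v t, HasDerivAt (fun s => Z s v) (H (Z t v)) t := fun v t => hS (v, p v) t
  have hT : ∀ v, Z T v = (v, p v) := fun v => hST (v, p v)
  refine ⟨fun t => ((fst ℝ E E).comp (Z t) : E →L[ℝ] E), fun t => ((snd ℝ E E).comp (Z t) : E →L[ℝ] E),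
    fun v => by simp [hT], fun v => by simp [hT], fun v t => ⟨?_, ?_⟩⟩
  · exact ((fst ℝ E E).hasFDerivAt.comp_hasDerivAt t (hZ v t)).congr_deriv (by simp [H])
  · exact ((snd ℝ E E).hasFDerivAt.comp_hasDerivAt t (hZ v t)).congr_deriv (by simp [H])

/-! ### Conserved symplectic form and energy identity -/

namespace IsHamiltonianSolution

variable {a : E →L[ℝ] E} {b : F →L[ℝ] E} {c : E →L[ℝ] G} {x y x' y' : ℝ → E}

theorem continuous_state (h : IsHamiltonianSolution a b c x y) : Continuous x :=
  continuous_iff_continuousAt.2 fun t => (h t).1.continuousAt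

theorem continuous_costate (h : IsHamiltonianSolution a b c x y) : Continuous y :=
  continuous_iff_continuousAt.2 fun t => (h t).2.continuousAt

-- The symplectic form of two solutions is constant because the Hamiltonian system is linear with `b
-- b†` and `c† c` symmetric. This is the source of the symmetry of the feedback operators.
open ContinuousLinearMap in
theorem inner_sub_inner_eq (h : IsHamiltonianSolution a b c x y)
    (h' : IsHamiltonianSolution a b c x' y') (s t : ℝ) :
    inner ℝ (x s) (y' s) - inner ℝ (y s) (x' s) = inner ℝ (x t) (y' t) - inner ℝ (y t) (x' t) := by
  have hd : ∀ t, HasDerivAt (fun t => inner ℝ (x t) (y' t) - inner ℝ (y t) (x' t)) 0 t := by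
    intro t
    refine (((h t).1.inner ℝ (h' t).2).sub ((h t).2.inner ℝ (h' t).1)).congr_deriv ?_
    simp only [inner_sub_left, inner_sub_right, inner_neg_left, inner_neg_right,
      adjoint_inner_left, adjoint_inner_right]
    have hb : inner ℝ (b (adjoint b (y t))) (y' t) = inner ℝ (y t) (b (adjoint b (y' t))) := by
      rw [← adjoint_inner_right b, adjoint_inner_left b]
    linarith
  exact is_const_of_deriv_eq_zero (fun t => (hd t).differentiableAt) (fun t => (hd t).deriv) s t

-- The running cost of the control `-b† y` is the derivative of `-⟨y, x⟩`.
open ContinuousLinearMap in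
theorem integral_energy (h : IsHamiltonianSolution a b c x y) (s t : ℝ) :
    ∫ r in s..t, (‖c (x r)‖ ^ 2 + ‖adjoint b (y r)‖ ^ 2) =
      inner ℝ (y s) (x s) - inner ℝ (y t) (x t) := by
  have hx := h.continuous_state
  have hy := h.continuous_costate
  have := intervalIntegral.integral_eq_sub_of_hasDerivAt (a := s) (b := t)
    (f := fun t => -inner ℝ (y t) (x t))
    (f' := fun r => ‖c (x r)‖ ^ 2 + ‖adjoint b (y r)‖ ^ 2) (fun r _ => ?_)
    (by apply Continuous.intervalIntegrable; fun_prop)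
  · rw [this]; ring
  · refine ((h r).2.inner ℝ (h r).1).neg.congr_deriv ?_
    simp only [inner_sub_left, inner_sub_right, inner_neg_left,
      adjoint_inner_left, ← real_inner_self_eq_norm_sq, adjoint_inner_right]
    rw [← adjoint_inner_left b]
    simp only [adjoint_inner_left]
    rw [real_inner_comm (y r)]
    ring

end IsHamiltonianSolution

/-! ### Uniqueness for linear equations -/

/-- A continuous solution of the linear integral equation `z s = ∫ a z` vanishes. -/
theorem eqOn_zero_of_eq_integral (a : E →L[ℝ] E) {τ T : ℝ} {z : ℝ → E}
    (hz : ContinuousOn z (Icc τ T)) (h : ∀ s ∈ Icc τ T, z s = ∫ r in τ..s, a (z r)) :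
    ∀ s ∈ Icc τ T, z s = 0 := by
  intro s₀ hs₀
  have hτT : τ ≤ T := hs₀.1.trans hs₀.2
  -- Extending `z` by its endpoint values to a continuous function on `ℝ` makes the integral
  -- differentiable at every point, so that Grönwall's inequality applies.
  let w : ℝ → E := IccExtend hτT ((Icc τ T).domRestrict z)
  have hw : Continuous w := (continuousOn_iff_continuous_domRestrict.1 hz).Icc_extend'
  have hwz : ∀ s ∈ Icc τ T, w s = z s := fun s hs => by simp [w, IccExtend_of_mem hτT _ hs, domRestrict]
  have hint : ∀ s ∈ Icc τ T, z s = ∫ r in τ..s, a (w r) := by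
    intro s hs
    rw [h s hs]
    refine intervalIntegral.integral_congr fun r hr => ?_
    rw [uIcc_of_le hs.1] at hr
    simp only [hwz r ⟨hr.1, hr.2.trans hs.2⟩]
  have hd : ∀ s, HasDerivAt (fun s => ∫ r in τ..s, a (w r)) (a (w s)) s := fun s =>
    intervalIntegral.integral_hasDerivAt_right
      ((a.continuous.comp hw).intervalIntegrable _ _)
      (a.continuous.comp hw).stronglyMeasurable.stronglyMeasurableAtFilter
      (a.continuous.comp hw).continuousAt
  rw [hint s₀ hs₀]
  refine eq_zero_of_abs_deriv_le_mul_abs_self_of_eq_zero_right (K := ‖a‖)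
    (fun s _ => (hd s).continuousAt.continuousWithinAt) (fun s _ => (hd s).hasDerivWithinAt)
    (by simp) (fun s hs => ?_) s₀ hs₀
  rw [← hint s ⟨hs.1, hs.2.le⟩, hwz s ⟨hs.1, hs.2.le⟩]
  exact a.le_opNorm _

/-- Uniqueness for the terminal value problem `d' = -a d` in `(0, T)`, `d T = 0`. -/
theorem eqOn_zero_of_hasDerivAt_of_terminal (a : E →L[ℝ] E) {T : ℝ} {d : ℝ → E}
    (hd : ContinuousOn d (Icc 0 T)) (hd' : ∀ t ∈ Ioo 0 T, HasDerivAt d (-a (d t)) t)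
    (hT : d T = 0) : ∀ t ∈ Icc 0 T, d t = 0 := by
  -- The reversal `s ↦ T - s` turns the terminal condition into an initial one.
  have hmem : ∀ s ∈ Icc 0 T, T - s ∈ Icc 0 T := fun s hs =>
    ⟨by linarith [hs.2], by linarith [hs.1]⟩
  have hcont : ContinuousOn (fun s => d (T - s)) (Icc 0 T) :=
    hd.comp (by fun_prop) hmem
  have key := eqOn_zero_of_eq_integral a hcont fun s hs => by
    rw [intervalIntegral.integral_eq_sub_of_hasDerivAt_of_le (f := fun s => d (T - s)) hs.1
      (hcont.mono (Icc_subset_Icc_right hs.2)) ?_ ?_]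
    · simp [hT]
    · intro r hr
      have := (hd' (T - r) ⟨by linarith [hr.2, hs.2], by linarith [hr.1]⟩).scomp r
        ((hasDerivAt_id r).const_sub T)
      simpa [Function.comp_def] using this
    · apply ContinuousOn.intervalIntegrable
      rw [uIcc_of_le hs.1]
      exact a.continuous.comp_continuousOn (hcont.mono (Icc_subset_Icc_right hs.2))
  intro t ht
  simpa using key (T - t) (hmem t ht)

open ContinuousLinearMap in
/-- A Hamiltonian solution with terminal condition `y T = p (x T)` whose state vanishes at some
earlier time has vanishing terminal state. -/
theorem IsHamiltonianSolution.state_terminal_eq_zero {a : E →L[ℝ] E} {b : F →L[ℝ] E}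
    {c : E →L[ℝ] G} {p : E →L[ℝ] E} {x y : ℝ → E} (hp : ∀ v, 0 ≤ inner ℝ (p v) v) {τ T : ℝ}
    (hτ : τ ≤ T) (h : IsHamiltonianSolution a b c x y) (hT : y T = p (x T)) (hx : x τ = 0) :
    x T = 0 := by
  have hxc := h.continuous_state
  have hyc := h.continuous_costate
  -- As `x τ = 0`, the energy integral equals `-⟨p (x T), x T⟩ ≤ 0`, so its continuous nonnegative
  -- integrand cannot be positive anywhere. Positivity of the integral needs `τ < T`; for `τ = T`
  -- the terminal condition gives the claim.
  have hb : ∀ r ∈ Icc τ T, adjoint b (y r) = 0 := by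
    have hcont : Continuous fun r => ‖c (x r)‖ ^ 2 + ‖adjoint b (y r)‖ ^ 2 := by fun_prop
    by_contra! ⟨r, hr, hne⟩
    have hlt : τ < T := by
      refine hτ.lt_of_ne fun hEq => hne ?_
      subst hEq
      obtain rfl : r = τ := le_antisymm hr.2 hr.1
      rw [hT, hx, map_zero, map_zero]
    have hpos := intervalIntegral.integral_pos hlt hcont.continuousOn
      (fun r _ => by positivity) ⟨r, hr, by positivity⟩
    rw [h.integral_energy, hx, inner_zero_right, hT] at hpos
    linarith [hp (x T)]
  -- Without the control term `x` solves `x' = a x` from `0`.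
  refine eqOn_zero_of_eq_integral a hxc.continuousOn (fun s hs => ?_) T ⟨hτ, le_rfl⟩
  rw [intervalIntegral.integral_eq_sub_of_hasDerivAt (f := x)
    (f' := fun r => a (x r)) (fun r hr => ?_)
    ((a.continuous.comp hxc).intervalIntegrable _ _), hx, sub_zero]
  rw [uIcc_of_le hs.1] at hr
  simpa [hb r ⟨hr.1, hr.2.trans hs.2⟩] using (h r).1

/-- The feedback operators `P t = Y t ∘ (X t)⁻¹` obtained from the Hamiltonian flow. -/
theorem exists_symmetric_feedback (a : E →L[ℝ] E) (b : F →L[ℝ] E) (c : E →L[ℝ] G)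
    (p : E →L[ℝ] E) (hps : (p : E →ₗ[ℝ] E).IsSymmetric) (hp : ∀ v, 0 ≤ inner ℝ (p v) v) (T : ℝ) :
    ∃ P : ℝ → E →ₗ[ℝ] E, ∀ τ ≤ T, (P τ).IsSymmetric ∧ ∀ ξ, ∃ x y,
      IsHamiltonianSolution a b c x y ∧ y T = p (x T) ∧ x τ = ξ ∧ ∀ t ≤ T, y t = P t (x t) := by
  obtain ⟨X, Y, hX, hY, hXY⟩ := exists_hamiltonian_flow a b c p T
  have hinj : ∀ t ≤ T, Function.Injective (X t) := by
    intro t ht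
    rw [injective_iff_map_eq_zero]
    intro v hv
    have := (hXY v).state_terminal_eq_zero hp ht (by simp [hX, hY]) hv
    simpa [hX] using this
  have hsurj : ∀ t ≤ T, Function.Surjective (X t) := fun t ht =>
    LinearMap.injective_iff_surjective.1 (hinj t ht)
  have hinv : ∀ t, ∃ R : E →ₗ[ℝ] E, t ≤ T → ∀ v, R (X t v) = v := by
    intro t
    by_cases ht : t ≤ T
    · obtain ⟨R, hR⟩ := (X t).exists_leftInverse_of_injective (LinearMap.ker_eq_bot.2 (hinj t ht))
      exact ⟨R, fun _ v => LinearMap.congr_fun hR v⟩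
    · exact ⟨0, fun h => absurd h ht⟩
  choose R hR using hinv
  refine ⟨fun t => Y t ∘ₗ R t, fun τ hτ => ⟨fun ξ η => ?_, fun ξ => ?_⟩⟩
  -- At time `T` the symplectic form is `⟨v, p w⟩ - ⟨p v, w⟩ = 0`; hence it vanishes at `τ` too,
  -- which is the symmetry of `Y τ ∘ R τ`.
  · obtain ⟨v, rfl⟩ := hsurj τ hτ ξ
    obtain ⟨w, rfl⟩ := hsurj τ hτ η
    simp only [LinearMap.comp_apply, hR τ hτ]
    have := (hXY v).inner_sub_inner_eq (hXY w) τ T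
    simp only [hX, hY] at this
    have h2 : inner ℝ (p v) w = inner ℝ v (p w) := hps v w
    linarith
  · obtain ⟨v, rfl⟩ := hsurj τ hτ ξ
    exact ⟨_, _, hXY v, by simp [hX, hY], rfl, fun t ht => by simp [hR t ht]⟩

/-! ### Integration by parts -/

/-- Integration by parts for the product of a `C¹` function and an absolutely continuous one. -/
theorem integral_inner_deriv_add_inner_eq_sub {τ T : ℝ} (hτ : τ ≤ T) {y y' x g : ℝ → E} {ξ : E}
    (hy : ∀ t, HasDerivAt y (y' t) t) (hy' : Continuous y')
    (hg : IntervalIntegrable g volume τ T) (hxc : ContinuousOn x (Icc τ T))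
    (hx : ∀ s ∈ Icc τ T, x s = ξ + ∫ r in τ..s, g r) :
    ∫ s in τ..T, (inner ℝ (y' s) (x s) + inner ℝ (y s) (g s)) =
      inner ℝ (y T) (x T) - inner ℝ (y τ) ξ := by
  -- Coordinates reduce the claim to the scalar product rule for absolutely continuous functions. In
  -- each coordinate `x` splits into the constant `ξ`, treated by `hFd`, and the primitive of `g`,
  -- treated by `hmain`.
  let e := stdOrthonormalBasis ℝ E
  have hyc : Continuous y := continuous_iff_continuousAt.2 fun t => (hy t).continuousAt
  have hgi : ∀ i, IntervalIntegrable (fun s => inner ℝ (e i) (g s)) volume τ T := fun i =>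
    ⟨hg.1.const_inner _, hg.2.const_inner _⟩
  have hxi : ∀ i, ∀ s ∈ Icc τ T,
      inner ℝ (e i) (x s) = inner ℝ (e i) ξ + ∫ r in τ..s, inner ℝ (e i) (g r) := by
    intro i s hs
    have hs' : IntervalIntegrable g volume τ s :=
      hg.mono_set (by rw [uIcc_of_le hs.1, uIcc_of_le hτ]; exact Icc_subset_Icc_right hs.2)
    rw [hx s hs, inner_add_right]
    congr 1
    exact ((innerSL ℝ (e i)).intervalIntegral_comp_comm hs').symm
  have hcoord : ∀ i, ∫ s in τ..T, (inner ℝ (y' s) (e i) * inner ℝ (e i) (x s) +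
      inner ℝ (y s) (e i) * inner ℝ (e i) (g s)) =
      inner ℝ (y T) (e i) * inner ℝ (e i) (x T) - inner ℝ (y τ) (e i) * inner ℝ (e i) ξ := by
    intro i
    have hfd : ∀ t, HasDerivAt (fun t => inner ℝ (y t) (e i)) (inner ℝ (y' t) (e i)) t := fun t =>
      ((hy t).inner ℝ (hasDerivAt_const t (e i))).congr_deriv (by simp)
    have hf : AbsolutelyContinuousOnInterval (fun t => inner ℝ (y t) (e i)) τ T := by
      apply ContDiffOn.absolutelyContinuousOnInterval
      apply ContDiff.contDiffOn
      rw [contDiff_one_iff_deriv]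
      refine ⟨fun t => (hfd t).differentiableAt, ?_⟩
      rw [funext fun t => (hfd t).deriv]
      fun_prop
    have hI := (hgi i).absolutelyContinuousOnInterval_intervalIntegral (c := τ) left_mem_uIcc
    have hprod := hf.fun_mul hI
    have hFd := intervalIntegral.integral_eq_sub_of_hasDerivAt
      (f := fun t => inner ℝ (y t) (e i) * inner ℝ (e i) ξ) (a := τ) (b := T)
      (fun t _ => (hfd t).mul_const _)
      (by apply Continuous.intervalIntegrable; fun_prop)
    have hmain := hf.integral_deriv_mul_eq_sub hI
    have hcongr : ∫ s in τ..T, (inner ℝ (y' s) (e i) * (∫ r in τ..s, inner ℝ (e i) (g r)) +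
        inner ℝ (y s) (e i) * inner ℝ (e i) (g s)) =
        inner ℝ (y T) (e i) * ∫ r in τ..T, inner ℝ (e i) (g r) := by
      rw [intervalIntegral.integral_same, mul_zero, sub_zero] at hmain
      rw [← hmain]
      refine intervalIntegral.integral_congr_ae ?_
      filter_upwards [(hgi i).ae_hasDerivAt_integral] with s hs hsm
      rw [(hs (uIoc_subset_uIcc hsm) τ left_mem_uIcc).deriv, (hfd s).deriv]
    rw [hxi i T ⟨hτ, le_rfl⟩, mul_add, ← hcongr, add_sub_right_comm, ← hFd,
      ← intervalIntegral.integral_add]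
    · refine intervalIntegral.integral_congr fun s hs => ?_
      rw [uIcc_of_le hτ] at hs
      simp only [hxi i s hs]
      ring
    · apply Continuous.intervalIntegrable; fun_prop
    · apply IntervalIntegrable.add
      · apply ContinuousOn.intervalIntegrable
        exact ContinuousOn.mul (by fun_prop) hI.continuousOn
      · exact (hgi i).continuousOn_mul (by fun_prop)
  have hsum : ∀ v w : E, inner ℝ v w = ∑ i, inner ℝ v (e i) * inner ℝ (e i) w := fun v w =>
    (e.sum_inner_mul_inner v w).symm
  rw [hsum (y T), hsum (y τ), ← Finset.sum_sub_distrib]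
  simp only [← hcoord]
  rw [← intervalIntegral.integral_finsetSum]
  · refine intervalIntegral.integral_congr fun s _ => ?_
    simp only [Finset.sum_add_distrib, ← hsum]
  · intro i _
    apply IntervalIntegrable.add
    · apply ContinuousOn.intervalIntegrable
      rw [uIcc_of_le hτ]
      exact ContinuousOn.mul (by fun_prop) (by fun_prop)
    · exact (hgi i).continuousOn_mul (by fun_prop)

theorem IntervalIntegrable.continuous_inner {s t : ℝ} {f g : ℝ → E} (hf : Continuous f)
    (hg : IntervalIntegrable g volume s t) :
    IntervalIntegrable (fun r => inner ℝ (f r) (g r)) volume s t := by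
  obtain ⟨M, hM⟩ := isCompact_uIcc.exists_bound_of_continuousOn (hf.continuousOn (s := uIcc s t))
  rw [intervalIntegrable_iff] at hg ⊢
  refine (hg.norm.const_mul M).mono' (hf.aestronglyMeasurable.inner hg.1) ?_
  filter_upwards [ae_restrict_mem measurableSet_uIoc] with r hr
  exact (norm_inner_le_norm _ _).trans
    (mul_le_mul_of_nonneg_right (hM r (uIoc_subset_uIcc hr)) (norm_nonneg _))

/-! ### Completion of squares and uniqueness of the minimizer -/

namespace IsHamiltonianSolution

variable {a : E →L[ℝ] E} {b : F →L[ℝ] E} {c : E →L[ℝ] G} {p : E →L[ℝ] E} {x y z : ℝ → E}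
  {u : ℝ → F} {τ T : ℝ}

open ContinuousLinearMap

theorem memLp_add_adjoint (h : IsHamiltonianSolution a b c x y)
    (hu : MemLp u 2 (volume.restrict (Ioo τ T))) :
    MemLp (fun s => u s + adjoint b (y s)) 2 (volume.restrict (Ioo τ T)) := by
  have hc : Continuous fun s => adjoint b (y s) := by
    have := h.continuous_costate
    fun_prop
  obtain ⟨M, hM⟩ := isCompact_Icc.exists_bound_of_continuousOn (hc.continuousOn (s := Icc τ T))
  refine hu.add (MemLp.of_bound hc.aestronglyMeasurable M ?_)
  filter_upwards [ae_restrict_mem measurableSet_Ioo] with s hs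
  exact hM s (Ioo_subset_Icc_self hs)

/-- The deviation integrand of the cost is integrable. -/
theorem intervalIntegrable_deviation (h : IsHamiltonianSolution a b c x y) (hτ : τ ≤ T)
    (hu : MemLp u 2 (volume.restrict (Ioo τ T))) (hz : ContinuousOn z (Icc τ T)) :
    IntervalIntegrable (fun s => ‖c (z s - x s)‖ ^ 2 + ‖u s + adjoint b (y s)‖ ^ 2)
      volume τ T := by
  have hx := h.continuous_state
  refine IntervalIntegrable.add ?_ ?_
  · apply ContinuousOn.intervalIntegrable
    rw [uIcc_of_le hτ]
    fun_prop
  · rw [intervalIntegrable_iff_integrableOn_Ioo_of_le hτ]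
    exact (h.memLp_add_adjoint hu).integrable_norm_pow two_ne_zero

/-- Completion of squares along an extremal `(x, y)`: the cost of an arbitrary admissible pair
`(z, u)` with the same initial state. -/
theorem cost_eq (h : IsHamiltonianSolution a b c x y) (hp : (p : E →ₗ[ℝ] E).IsSymmetric)
    (hT : y T = p (x T)) (hτ : τ ≤ T)
    (hu : MemLp u 2 (volume.restrict (Ioo τ T))) (hzc : ContinuousOn z (Icc τ T))
    (hz : ∀ s ∈ Icc τ T, z s = x τ + ∫ r in τ..s, (a (z r) + b (u r))) :
    (∫ s in τ..T, (‖c (z s)‖ ^ 2 + ‖u s‖ ^ 2)) + inner ℝ (p (z T)) (z T) =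
      inner ℝ (y τ) (x τ) + (∫ s in τ..T, (‖c (z s - x s)‖ ^ 2 + ‖u s + adjoint b (y s)‖ ^ 2)) +
        inner ℝ (p (z T - x T)) (z T - x T) := by
  have hxc := h.continuous_state
  have hyc := h.continuous_costate
  have hzc' : ContinuousOn z (uIcc τ T) := by rwa [uIcc_of_le hτ]
  have hui : IntervalIntegrable u volume τ T := by
    rw [intervalIntegrable_iff_integrableOn_Ioo_of_le hτ]
    exact hu.integrable one_le_two
  have hbu : IntervalIntegrable (fun s => b (u s)) volume τ T :=
    ⟨b.integrable_comp hui.1, b.integrable_comp hui.2⟩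
  have haz : IntervalIntegrable (fun s => a (z s)) volume τ T :=
    ContinuousOn.intervalIntegrable (by fun_prop)
  have hg : IntervalIntegrable (fun s => a (z s) + b (u s)) volume τ T := haz.add hbu
  have hibp := integral_inner_deriv_add_inner_eq_sub hτ (fun t => (h t).2) (by fun_prop) hg hzc hz
  have henergy := h.integral_energy τ T
  have hdev := h.intervalIntegrable_deviation hτ hu hzc
  have hen : IntervalIntegrable (fun r => ‖c (x r)‖ ^ 2 + ‖adjoint b (y r)‖ ^ 2) volume τ T := by
    apply Continuous.intervalIntegrable
    fun_prop
  have hcross : IntervalIntegrable (fun s => inner ℝ (-adjoint a (y s) - adjoint c (c (x s))) (z s) +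
      inner ℝ (y s) (a (z s) + b (u s))) volume τ T := by
    refine IntervalIntegrable.add (ContinuousOn.intervalIntegrable ?_) (hg.continuous_inner hyc)
    fun_prop
  -- The bracket multiplied by `2` is the derivative of `⟨y, z⟩` almost everywhere, and the last one
  -- is the energy density of the extremal, so both integrate to boundary terms.
  have hsq : ∀ s, ‖c (z s)‖ ^ 2 + ‖u s‖ ^ 2 =
      (‖c (z s - x s)‖ ^ 2 + ‖u s + adjoint b (y s)‖ ^ 2) -
      2 * (inner ℝ (-adjoint a (y s) - adjoint c (c (x s))) (z s) +
        inner ℝ (y s) (a (z s) + b (u s))) -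
      (‖c (x s)‖ ^ 2 + ‖adjoint b (y s)‖ ^ 2) := by
    intro s
    have hby : inner ℝ (u s) (adjoint b (y s)) = inner ℝ (y s) (b (u s)) := by
      rw [adjoint_inner_right, real_inner_comm]
    rw [map_sub, norm_sub_sq_real, norm_add_sq_real, inner_sub_left, inner_neg_left,
      inner_add_right, adjoint_inner_left, adjoint_inner_left, hby,
      real_inner_comm (c (z s)) (c (x s))]
    ring
  have hint : ∫ s in τ..T, (‖c (z s)‖ ^ 2 + ‖u s‖ ^ 2) =
      (∫ s in τ..T, (‖c (z s - x s)‖ ^ 2 + ‖u s + adjoint b (y s)‖ ^ 2)) -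
      2 * (inner ℝ (y T) (z T) - inner ℝ (y τ) (x τ)) -
      (inner ℝ (y τ) (x τ) - inner ℝ (y T) (x T)) := by
    rw [← henergy, ← hibp, ← intervalIntegral.integral_const_mul,
      ← intervalIntegral.integral_sub hdev (hcross.const_mul 2),
      ← intervalIntegral.integral_sub (hdev.sub (hcross.const_mul 2)) hen]
    exact intervalIntegral.integral_congr fun s _ => hsq s
  -- Symmetry of `p` lets the boundary terms at `T` combine into the quadratic form of `z T - x T`.
  have hs : inner ℝ (p (z T)) (x T) = inner ℝ (p (x T)) (z T) := by
    rw [real_inner_comm]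
    exact (hp (x T) (z T)).symm
  rw [hint, hT, map_sub]
  simp only [inner_sub_left, inner_sub_right, hs]
  ring

/-- The extremal is a trajectory for the control `-b† y`. -/
theorem state_eq_integral (h : IsHamiltonianSolution a b c x y) (τ s : ℝ) :
    x s = x τ + ∫ r in τ..s, (a (x r) + b (-adjoint b (y r))) := by
  have hxc := h.continuous_state
  have hyc := h.continuous_costate
  rw [intervalIntegral.integral_eq_sub_of_hasDerivAt (f := x)]
  · abel
  · intro r _
    simpa [sub_eq_add_neg] using (h r).1
  · apply Continuous.intervalIntegrable
    fun_prop

theorem memLp_control (h : IsHamiltonianSolution a b c x y) (τ T : ℝ) :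
    MemLp (fun s => -adjoint b (y s)) 2 (volume.restrict (Ioo τ T)) := by
  have := h.memLp_add_adjoint (u := fun _ => 0) (τ := τ) (T := T) MemLp.zero'
  simpa [Pi.neg_def] using this.neg

/-- The extremal is the only pair whose cost does not exceed `⟨y τ, x τ⟩`. -/
theorem eq_of_cost_le (h : IsHamiltonianSolution a b c x y) (hps : (p : E →ₗ[ℝ] E).IsSymmetric)
    (hp : ∀ v, 0 ≤ inner ℝ (p v) v) (hT : y T = p (x T)) (hτ : τ ≤ T)
    (hu : MemLp u 2 (volume.restrict (Ioo τ T))) (hzc : ContinuousOn z (Icc τ T))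
    (hz : ∀ s ∈ Icc τ T, z s = x τ + ∫ r in τ..s, (a (z r) + b (u r)))
    (hle : (∫ s in τ..T, (‖c (z s)‖ ^ 2 + ‖u s‖ ^ 2)) + inner ℝ (p (z T)) (z T) ≤
      inner ℝ (y τ) (x τ)) :
    (∀ᵐ t ∂(volume.restrict (Ioo τ T)), u t = -adjoint b (y t)) ∧ EqOn z x (Icc τ T) := by
  have hxc := h.continuous_state
  have hyc := h.continuous_costate
  have hdev := h.intervalIntegrable_deviation hτ hu hzc
  rw [h.cost_eq hps hT hτ hu hzc hz] at hle
  have hzero : ∫ s in τ..T, (‖c (z s - x s)‖ ^ 2 + ‖u s + adjoint b (y s)‖ ^ 2) = 0 := by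
    refine le_antisymm (by linarith [hp (z T - x T)]) ?_
    exact intervalIntegral.integral_nonneg hτ fun s _ => by positivity
  have hae : ∀ᵐ t ∂(volume.restrict (Ioc τ T)), u t = -adjoint b (y t) := by
    rw [intervalIntegral.integral_eq_zero_iff_of_le_of_nonneg_ae hτ
      (Filter.Eventually.of_forall fun s => by simp only [Pi.zero_apply]; positivity) hdev] at hzero
    filter_upwards [hzero] with t ht
    simp only [Pi.zero_apply] at ht
    have h0 : ‖u t + adjoint b (y t)‖ ^ 2 = 0 :=
      le_antisymm (by linarith [sq_nonneg ‖c (z t - x t)‖]) (sq_nonneg _)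
    exact eq_neg_of_add_eq_zero_left (norm_eq_zero.1 (pow_eq_zero_iff two_ne_zero |>.1 h0))
  refine ⟨ae_restrict_of_ae_restrict_of_subset Ioo_subset_Ioc_self hae, ?_⟩
  -- Both states are driven by the same control almost everywhere, so their difference solves the
  -- homogeneous equation from `0`.
  have hdiff := eqOn_zero_of_eq_integral a (z := fun s => z s - x s) (hzc.sub hxc.continuousOn)
    fun s hs => ?_
  · exact fun s hs => sub_eq_zero.1 (hdiff s hs)
  · have hzs : z s = x τ + ∫ r in τ..s, (a (z r) + b (-adjoint b (y r))) := by
      rw [hz s hs]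
      congr 1
      refine intervalIntegral.integral_congr_ae ?_
      rw [uIoc_of_le hs.1, ← ae_restrict_iff' measurableSet_Ioc]
      filter_upwards [ae_restrict_of_ae_restrict_of_subset (Ioc_subset_Ioc_right hs.2) hae]
        with r hr
      rw [hr]
    have hzi : ContinuousOn z (uIcc τ s) := by
      rw [uIcc_of_le hs.1]
      exact hzc.mono (Icc_subset_Icc_right hs.2)
    rw [hzs, h.state_eq_integral τ s, add_sub_add_left_eq_sub,
      ← intervalIntegral.integral_sub]
    · exact intervalIntegral.integral_congr fun r _ => by simp
    · apply ContinuousOn.intervalIntegrable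
      fun_prop
    · apply Continuous.intervalIntegrable
      fun_prop

end IsHamiltonianSolution

end Abstract

/-! ### Translation to matrices -/

theorem adjoint_toEuclideanLin_apply {k l : ℕ} (M : Matrix (Fin k) (Fin l) ℝ)
    (v : EuclideanSpace ℝ (Fin k)) :
    ContinuousLinearMap.adjoint (LinearMap.toContinuousLinearMap (Matrix.toEuclideanLin M)) v =
      Matrix.toEuclideanLin M.transpose v := by
  rw [← LinearMap.adjoint_toContinuousLinearMap, ← Matrix.toEuclideanLin_conjTranspose_eq_adjoint,
    Matrix.conjTranspose_eq_transpose_of_trivial]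
  rfl

theorem toEuclideanLin_transpose_mul_apply {k l : ℕ} (M : Matrix (Fin k) (Fin l) ℝ)
    (v : EuclideanSpace ℝ (Fin l)) :
    Matrix.toEuclideanLin (M.transpose * M) v =
      Matrix.toEuclideanLin M.transpose (Matrix.toEuclideanLin M v) := by
  simp [Matrix.toLpLin_apply, Matrix.mulVec_mulVec]

theorem Matrix.isSymm_iff_isSymmetric_toEuclideanLin {k : ℕ} {M : Matrix (Fin k) (Fin k) ℝ} :
    M.IsSymm ↔ (Matrix.toEuclideanLin M).IsSymmetric := by
  rw [Matrix.isSymmetric_toEuclideanLin_iff, Matrix.IsHermitian,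
    Matrix.conjTranspose_eq_transpose_of_trivial, Matrix.IsSymm]

section LQ

variable {n p m : ℕ} {A : Matrix (Fin n) (Fin n) ℝ} {B : Matrix (Fin n) (Fin p) ℝ}
  {C : Matrix (Fin m) (Fin n) ℝ} {P₀ : Matrix (Fin n) (Fin n) ℝ} {T τ : ℝ}

/-- `(x, y)` solves the optimality system `x' = A x - B Bᵀ y`, `y' = -Aᵀ y - Cᵀ C x`,
`y(T) = P₀ x(T)`. -/
def IsLQExtremal (A : Matrix (Fin n) (Fin n) ℝ) (B : Matrix (Fin n) (Fin p) ℝ)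
    (C : Matrix (Fin m) (Fin n) ℝ) (P₀ : Matrix (Fin n) (Fin n) ℝ) (T : ℝ)
    (x y : ℝ → EuclideanSpace ℝ (Fin n)) : Prop :=
  IsHamiltonianSolution (LinearMap.toContinuousLinearMap (Matrix.toEuclideanLin A))
    (LinearMap.toContinuousLinearMap (Matrix.toEuclideanLin B))
    (LinearMap.toContinuousLinearMap (Matrix.toEuclideanLin C)) x y ∧
  y T = Matrix.toEuclideanLin P₀ (x T)

theorem Matrix.PosSemidef.inner_toEuclideanLin_nonneg (hP₀ : P₀.PosSemidef)
    (v : EuclideanSpace ℝ (Fin n)) : 0 ≤ inner ℝ (Matrix.toEuclideanLin P₀ v) v := by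
  simpa using (Matrix.isPositive_toEuclideanLin_iff.2 hP₀).2 v

theorem Matrix.PosSemidef.isSymmetric_toEuclideanLin (hP₀ : P₀.PosSemidef) :
    (Matrix.toEuclideanLin P₀).IsSymmetric :=
  (Matrix.isPositive_toEuclideanLin_iff.2 hP₀).1

/-- The Riccati matrices. -/
theorem exists_riccati_matrix (A : Matrix (Fin n) (Fin n) ℝ) (B : Matrix (Fin n) (Fin p) ℝ)
    (C : Matrix (Fin m) (Fin n) ℝ) (hP₀ : P₀.PosSemidef) (T : ℝ) :
    ∃ P : ℝ → Matrix (Fin n) (Fin n) ℝ, ∀ τ ≤ T, (P τ).IsSymm ∧ ∀ ξ, ∃ x y,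
      IsLQExtremal A B C P₀ T x y ∧ x τ = ξ ∧
        ∀ t ≤ T, y t = Matrix.toEuclideanLin (P t) (x t) := by
  obtain ⟨P, hP⟩ := exists_symmetric_feedback
    (LinearMap.toContinuousLinearMap (Matrix.toEuclideanLin A))
    (LinearMap.toContinuousLinearMap (Matrix.toEuclideanLin B))
    (LinearMap.toContinuousLinearMap (Matrix.toEuclideanLin C))
    (LinearMap.toContinuousLinearMap (Matrix.toEuclideanLin P₀))
    hP₀.isSymmetric_toEuclideanLin hP₀.inner_toEuclideanLin_nonneg T
  refine ⟨fun t => Matrix.toEuclideanLin.symm (P t), fun τ hτ => ⟨?_, fun ξ => ?_⟩⟩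
  · rw [Matrix.isSymm_iff_isSymmetric_toEuclideanLin, LinearEquiv.apply_symm_apply]
    exact (hP τ hτ).1
  · obtain ⟨x, y, h, hT, hx, hy⟩ := (hP τ hτ).2 ξ
    exact ⟨x, y, ⟨h, hT⟩, hx, fun t ht => by rw [LinearEquiv.apply_symm_apply, hy t ht]⟩

namespace IsLQExtremal

variable {x y z : ℝ → EuclideanSpace ℝ (Fin n)} {u : ℝ → EuclideanSpace ℝ (Fin p)}

theorem isLQAdmissible (h : IsLQExtremal A B C P₀ T x y) (τ : ℝ) :
    IsLQAdmissible A B τ T (x τ) x (fun t => -Matrix.toEuclideanLin B.transpose (y t)) := by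
  simp only [← adjoint_toEuclideanLin_apply]
  exact ⟨h.1.memLp_control τ T, h.1.continuous_state.continuousOn,
    fun s _ => h.1.state_eq_integral τ s⟩

theorem le_lqCost (h : IsLQExtremal A B C P₀ T x y) (hP₀ : P₀.PosSemidef) (hτ : τ ≤ T)
    (hz : IsLQAdmissible A B τ T (x τ) z u) :
    inner ℝ (y τ) (x τ) ≤ lqCost C P₀ τ T z u := by
  have hcost := h.1.cost_eq (p := LinearMap.toContinuousLinearMap (Matrix.toEuclideanLin P₀))
    hP₀.isSymmetric_toEuclideanLin h.2 hτ hz.1 hz.2.1 hz.2.2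
  refine le_of_le_of_eq ?_ hcost.symm
  have h1 := hP₀.inner_toEuclideanLin_nonneg (z T - x T)
  simp only [LinearMap.coe_toContinuousLinearMap']
  refine le_add_of_le_of_nonneg (le_add_of_nonneg_right ?_) h1
  exact intervalIntegral.integral_nonneg hτ fun s _ => by positivity

theorem lqCost_eq (h : IsLQExtremal A B C P₀ T x y) (τ : ℝ) :
    lqCost C P₀ τ T x (fun t => -Matrix.toEuclideanLin B.transpose (y t)) =
      inner ℝ (y τ) (x τ) := by
  have := h.1.integral_energy τ T
  simp only [adjoint_toEuclideanLin_apply, LinearMap.coe_toContinuousLinearMap'] at this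
  simp only [lqCost, norm_neg, this, h.2, sub_add_cancel]

theorem isLQOptimal (h : IsLQExtremal A B C P₀ T x y) (hP₀ : P₀.PosSemidef) (hτ : τ ≤ T) :
    IsLQOptimal A B C P₀ τ T (x τ) x (fun t => -Matrix.toEuclideanLin B.transpose (y t)) :=
  ⟨h.isLQAdmissible τ, fun _ _ hz => (h.lqCost_eq τ).trans_le (h.le_lqCost hP₀ hτ hz)⟩

theorem isLeast_lqCost (h : IsLQExtremal A B C P₀ T x y) (hP₀ : P₀.PosSemidef) (hτ : τ ≤ T) :
    IsLeast {J : ℝ | ∃ z u, IsLQAdmissible A B τ T (x τ) z u ∧ J = lqCost C P₀ τ T z u}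
      (inner ℝ (y τ) (x τ)) := by
  refine ⟨⟨_, _, h.isLQAdmissible τ, (h.lqCost_eq τ).symm⟩, ?_⟩
  rintro _ ⟨z, u, hz, rfl⟩
  exact h.le_lqCost hP₀ hτ hz

theorem eq_of_isLQOptimal (h : IsLQExtremal A B C P₀ T x y) (hP₀ : P₀.PosSemidef) (hτ : τ ≤ T)
    (hz : IsLQOptimal A B C P₀ τ T (x τ) z u) :
    (∀ᵐ t ∂(volume.restrict (Ioo τ T)), u t = -Matrix.toEuclideanLin B.transpose (y t)) ∧
      EqOn z x (Icc τ T) := by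
  have hle := (hz.2 _ _ (h.isLQAdmissible τ)).trans_eq (h.lqCost_eq τ)
  have := h.1.eq_of_cost_le (p := LinearMap.toContinuousLinearMap (Matrix.toEuclideanLin P₀))
    hP₀.isSymmetric_toEuclideanLin hP₀.inner_toEuclideanLin_nonneg h.2 hτ hz.1.1 hz.1.2.1
    hz.1.2.2 hle
  simpa only [adjoint_toEuclideanLin_apply] using this

/-- The state is a separate `z` because an optimal trajectory is determined only on `[0, T]`,
whereas `x` solves its equation on all of `ℝ`. -/
theorem isLQAdjointState (h : IsLQExtremal A B C P₀ T x y) (hT : 0 ≤ T)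
    (hz : EqOn z x (Icc 0 T)) : IsLQAdjointState A C P₀ T z y := by
  refine ⟨h.1.continuous_costate.continuousOn, fun t ht => ?_, ?_⟩
  · rw [hz (Ioo_subset_Icc_self ht), toEuclideanLin_transpose_mul_apply]
    have := (h.1 t).2
    simp only [adjoint_toEuclideanLin_apply, LinearMap.coe_toContinuousLinearMap'] at this
    exact this
  · rw [hz ⟨hT, le_rfl⟩, h.2]

end IsLQExtremal

theorem IsLQAdjointState.eqOn {x y y' : ℝ → EuclideanSpace ℝ (Fin n)}
    (h : IsLQAdjointState A C P₀ T x y) (h' : IsLQAdjointState A C P₀ T x y') :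
    EqOn y y' (Icc 0 T) := by
  intro t ht
  refine sub_eq_zero.1 (eqOn_zero_of_hasDerivAt_of_terminal (d := fun t => y t - y' t)
    (LinearMap.toContinuousLinearMap (Matrix.toEuclideanLin A.transpose)) (h.1.sub h'.1)
    (fun t ht => ?_) (by simp [h.2.2, h'.2.2]) t ht)
  refine ((h.2.1 t ht).sub (h'.2.1 t ht)).congr_deriv ?_
  simp only [LinearMap.coe_toContinuousLinearMap', map_sub]
  abel

/-- A symmetric operator with vanishing quadratic form is zero. -/
theorem IsLQValueMatrix.unique {P Q : Matrix (Fin n) (Fin n) ℝ}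
    (hP : IsLQValueMatrix A B C P₀ T τ P) (hQ : IsLQValueMatrix A B C P₀ T τ Q) : P = Q := by
  have hsymm := (Matrix.isSymm_iff_isSymmetric_toEuclideanLin.1 hP.1).sub
    (Matrix.isSymm_iff_isSymmetric_toEuclideanLin.1 hQ.1)
  apply Matrix.toEuclideanLin.injective
  rw [← sub_eq_zero, ← hsymm.inner_map_self_eq_zero]
  intro ξ
  rw [LinearMap.sub_apply, inner_sub_left, (hP.2 ξ).unique (hQ.2 ξ), sub_self]

end LQ

/-! ### The main theorem -/

theorem theorem9p1 {n p m : ℕ} (A : Matrix (Fin n) (Fin n) ℝ) (B : Matrix (Fin n) (Fin p) ℝ)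
    (C : Matrix (Fin m) (Fin n) ℝ) (P₀ : Matrix (Fin n) (Fin n) ℝ) (hP₀ : P₀.PosSemidef)
    (T : ℝ) (hT : 0 < T) :
    -- the matrices `P_T(τ)` are well defined
    (∀ τ ∈ Icc 0 T, ∃! P, IsLQValueMatrix A B C P₀ T τ P) ∧
    ∀ ξ : EuclideanSpace ℝ (Fin n),
      -- there is exactly one optimal solution
      (∃ x u, IsLQOptimal A B C P₀ 0 T ξ x u) ∧
      (∀ x u x' u', IsLQOptimal A B C P₀ 0 T ξ x u → IsLQOptimal A B C P₀ 0 T ξ x' u' →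
        (∀ᵐ t ∂(volume.restrict (Ioo 0 T)), u t = u' t) ∧ EqOn x x' (Icc 0 T)) ∧
      ∀ x u, IsLQOptimal A B C P₀ 0 T ξ x u →
        IsLQTrajectory A B 0 T ξ x u ∧
        (∃ y, IsLQAdjointState A C P₀ T x y) ∧
        ∀ y, IsLQAdjointState A C P₀ T x y →
          (∀ᵐ t ∂(volume.restrict (Ioo 0 T)),
            u t = -Matrix.toEuclideanLin B.transpose (y t)) ∧
          ∀ P : ℝ → Matrix (Fin n) (Fin n) ℝ,
            (∀ τ ∈ Icc 0 T, IsLQValueMatrix A B C P₀ T τ (P τ)) →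
              (∀ t ∈ Icc 0 T, y t = Matrix.toEuclideanLin (P t) (x t)) ∧
              (∀ᵐ t ∂(volume.restrict (Icc 0 T)),
                u t = -Matrix.toEuclideanLin B.transpose (Matrix.toEuclideanLin (P t) (x t))) := by
  obtain ⟨R, hR⟩ := exists_riccati_matrix A B C hP₀ T
  have hvalue : ∀ τ ≤ T, IsLQValueMatrix A B C P₀ T τ (R τ) := by
    refine fun τ hτ => ⟨(hR τ hτ).1, fun ξ => ?_⟩
    obtain ⟨x, y, h, rfl, hy⟩ := (hR τ hτ).2 ξ
    rw [← hy τ hτ]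
    exact (h.isLeast_lqCost hP₀ hτ).isGLB
  refine ⟨fun τ hτ => ⟨R τ, hvalue τ hτ.2, fun P hP => hP.unique (hvalue τ hτ.2)⟩, fun ξ => ?_⟩
  -- Every optimal pair and every adjoint state is compared with this one extremal through `ξ` at
  -- time `0`.
  obtain ⟨x₀, y₀, h, rfl, hy₀⟩ := (hR 0 hT.le).2 ξ
  refine ⟨⟨_, _, h.isLQOptimal hP₀ hT.le⟩, fun x u x' u' hx hx' => ?_, fun x u hx => ?_⟩
  · obtain ⟨hu, hxe⟩ := h.eq_of_isLQOptimal hP₀ hT.le hx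
    obtain ⟨hu', hxe'⟩ := h.eq_of_isLQOptimal hP₀ hT.le hx'
    refine ⟨?_, hxe.trans hxe'.symm⟩
    filter_upwards [hu, hu'] with t ht ht'
    rw [ht, ht']
  · obtain ⟨hu, hxe⟩ := h.eq_of_isLQOptimal hP₀ hT.le hx
    have hadj := h.isLQAdjointState hT.le hxe
    refine ⟨hx.1.2, ⟨y₀, hadj⟩, fun y hy => ?_⟩
    have hye := hy.eqOn hadj
    have huy : ∀ᵐ t ∂(volume.restrict (Ioo 0 T)),
        u t = -Matrix.toEuclideanLin B.transpose (y t) := by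
      filter_upwards [hu, ae_restrict_mem measurableSet_Ioo] with t ht htm
      rw [ht, hye (Ioo_subset_Icc_self htm)]
    refine ⟨huy, fun P hP => ?_⟩
    -- The given `P t` equals `R t` by uniqueness of the value matrix, and the feedback relation is
    -- known for `R t`.
    have hyP : ∀ t ∈ Icc 0 T, y t = Matrix.toEuclideanLin (P t) (x t) := fun t ht => by
      rw [hye ht, hxe ht, hy₀ t ht.2, (hP t ht).unique (hvalue t ht.2)]
    refine ⟨hyP, ?_⟩
    rw [← Measure.restrict_congr_set Ioo_ae_eq_Icc]
    filter_upwards [huy, ae_restrict_mem measurableSet_Ioo] with t ht htm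
    rw [ht, hyP t (Ioo_subset_Icc_self htm)]
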